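/- An impulse response is a real sequence $g=(g_t)_{t\ge 0}\in\ell^1$ (the impulse response of a stable causal discrete-time single-input single-output linear system). Its Hankel operator $\mathrm{Hankel}(g):\ell^\infty\to\ell^\infty$ is given by $(\mathrm{Hankel}(g)v)_i=\sum_{j\ge 0} g_{i+j}v_j$ for $i\ge 0$, and $g$ has finite Hankel rank if the range of $\mathrm{Hankel}(g)$ is finite-dimensional. The impulse response $g$ is internally positive if there are $n\ge 1$, $A\in\mathbb{R}^{n\times n}$, $b\in\mathbb{R}^{n}$, $c\in\mathbb{R}^{1\times n}$ and $d\in\mathbb{R}$ such that the system $x_{t+1}=Ax_t+bu_t$, $y_t=cx_t+du_t$ realizes $g$ (its output from the zero state under the unit impulse at time $0$ is $y_t=g_t$ for all $t\ge 0$) and such that, whenever $x_0\in\mathbb{R}_+^n$ and $u_t\ge 0$ for all $t\ge 0$, one has $x_t\in\mathbb{R}_+^n$ and $y_t\ge 0$ for all $t\ge 0$. Let $\mathscr{P}$ be the set of internally positive impulse responses. For $\rho\in(0,1)$ let $\mathscr{P}_\rho\subset\ell^1$ be the set of impulse responses $g$ of finite Hankel rank with $g_t\ge 0$ for all $t\ge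 0$ such that $\lim_{t\to\infty}\rho^{-t}g_t$ exists and equals some $a\in(0,\infty)$, and let $\mathscr{P}_{(0,1)}=\bigcup_{\rho\in(0,1)}\mathscr{P}_\rho$. Corollary. For every $\rho\in(0,1)$, each impulse response $g\in\mathscr{P}_\rho$ is internally positive, i.e. $\mathscr{P}_\rho\subseteq\mathscr{P}$. Moreover, $\mathscr{P}_{(0,1)}\subseteq\mathscr{P}$. -/

import Mathlib

open scoped ENNReal Topology Matrix

namespace PosSys

noncomputable section

/-- Impulse responses of stable causal discrete-time systems: real sequences
`(g_t)_{t ≥ 0}` in `ℓ¹`. -/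
abbrev ImpulseResponse : Type := lp (fun _ : ℕ => ℝ) 1

/-- Bounded sequences, the space `ℓ^∞` on which Hankel operators act. -/
abbrev BoundedSeq : Type := lp (fun _ : ℕ => ℝ) ∞

theorem summable_abs (g : ImpulseResponse) : Summable fun j => |g j| := by
  have h := (lp.memℓp g).summable (by norm_num)
  simpa using h

theorem hankel_bound (g : ImpulseResponse) (v : BoundedSeq) (i j : ℕ) :
    ‖g (i + j) * v j‖ ≤ |g (i + j)| * ‖v‖ := by
  rw [norm_mul]
  exact mul_le_mul_of_nonneg_left (lp.norm_apply_le_norm (by simp) v j) (abs_nonneg _)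

theorem summable_abs_shift (g : ImpulseResponse) (i : ℕ) :
    Summable fun j => |g (i + j)| :=
  (summable_abs g).comp_injective (add_right_injective i)

theorem hankel_summable (g : ImpulseResponse) (v : BoundedSeq) (i : ℕ) :
    Summable fun j => g (i + j) * v j :=
  Summable.of_norm_bounded ((summable_abs_shift g i).mul_right ‖v‖) (hankel_bound g v i)

theorem hankel_memℓp (g : ImpulseResponse) (v : BoundedSeq) :
    Memℓp (E := fun _ : ℕ => ℝ) (fun i => ∑' j, g (i + j) * v j) ∞ := by
  refine memℓp_infty ⟨(∑' j, |g j|) * ‖v‖, ?_⟩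
  rintro _ ⟨i, rfl⟩
  have h1 : ‖∑' j, g (i + j) * v j‖ ≤ ∑' j, |g (i + j)| * ‖v‖ :=
    tsum_of_norm_bounded ((summable_abs_shift g i).mul_right ‖v‖).hasSum (hankel_bound g v i)
  refine h1.trans ?_
  rw [tsum_mul_right]
  refine mul_le_mul_of_nonneg_right ?_ (norm_nonneg _)
  exact (summable_abs_shift g i).tsum_le_tsum_of_inj (fun j => i + j) (add_right_injective i)
    (fun _ _ => abs_nonneg _) (fun _ => le_rfl) (summable_abs g)

/-- The Hankel operator `Hankel(g) : ℓ^∞ → ℓ^∞` of an impulse response `g`, with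
matrix `[g_{i+j}]_{i,j ≥ 0}` in the standard basis: `(Hankel(g) v)_i = ∑_j g_{i+j} v_j`. -/
def hankel (g : ImpulseResponse) : BoundedSeq →ₗ[ℝ] BoundedSeq where
  toFun v := ⟨fun i => ∑' j, g (i + j) * v j, hankel_memℓp g v⟩
  map_add' v w := by
    ext i
    change ∑' j, g (i + j) * (v + w : BoundedSeq) j
      = (∑' j, g (i + j) * v j) + ∑' j, g (i + j) * w j
    rw [← (hankel_summable g v i).tsum_add (hankel_summable g w i)]
    exact tsum_congr fun j => by rw [lp.coeFn_add, Pi.add_apply, mul_add]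
  map_smul' r v := by
    ext i
    change ∑' j, g (i + j) * (r • v : BoundedSeq) j = r * ∑' j, g (i + j) * v j
    rw [← tsum_mul_left]
    exact tsum_congr fun j => by
      rw [lp.coeFn_smul, Pi.smul_apply, smul_eq_mul, mul_left_comm]

/-- `g` has finite Hankel rank: the range of `Hankel(g)` is finite-dimensional. -/
def FiniteHankelRank (g : ImpulseResponse) : Prop :=
  (hankel g).rank < Cardinal.aleph0

/-- The data of a single-input single-output linear state-space system
`x_{t+1} = A x_t + b u_t`, `y_t = c x_t + d u_t` with `n` states. -/
structure StateSpace (n : ℕ) where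
  A : Matrix (Fin n) (Fin n) ℝ
  b : Fin n → ℝ
  c : Fin n → ℝ
  d : ℝ

namespace StateSpace

variable {n : ℕ}

/-- The state trajectory from the initial state `x₀` under the input `u`. -/
def state (S : StateSpace n) (x₀ : Fin n → ℝ) (u : ℕ → ℝ) : ℕ → Fin n → ℝ
  | 0 => x₀
  | t + 1 => S.A *ᵥ S.state x₀ u t + u t • S.b

/-- The output from the initial state `x₀` under the input `u`. -/
def output (S : StateSpace n) (x₀ : Fin n → ℝ) (u : ℕ → ℝ) (t : ℕ) : ℝ :=
  S.c ⬝ᵥ S.state x₀ u t + S.d * u t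

/-- `S` is a realization of the system with impulse response `g`: its output from the
zero state under the unit impulse at time `0` is `g`. -/
def IsRealization (S : StateSpace n) (g : ImpulseResponse) : Prop :=
  ∀ t : ℕ, S.output 0 (Pi.single 0 1) t = g t

/-- Non-negative initial states and non-negative inputs give non-negative states and
outputs at all times `t ≥ 0`. -/
def IsPositive (S : StateSpace n) : Prop :=
  ∀ (x₀ : Fin n → ℝ) (u : ℕ → ℝ), 0 ≤ x₀ → (∀ t, 0 ≤ u t) →
    ∀ t, 0 ≤ S.state x₀ u t ∧ 0 ≤ S.output x₀ u t

end StateSpace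

/-- `g` is internally positive: it has a positive realization with `n ≥ 1` states. -/
def InternallyPositive (g : ImpulseResponse) : Prop :=
  ∃ n : ℕ, 0 < n ∧ ∃ S : StateSpace n, S.IsRealization g ∧ S.IsPositive

/-- The set of internally positive impulse responses. -/
def internallyPositiveSet : Set ImpulseResponse := {g | InternallyPositive g}

/-- The set `P_ρ` of non-negative impulse responses of finite Hankel rank such that
`ρ^{-t} g_t` converges to some `a ∈ (0, ∞)`. -/
def dominantPoleSet (ρ : ℝ) : Set ImpulseResponse :=
  {g | (∀ t, 0 ≤ g t) ∧ FiniteHankelRank g ∧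
    ∃ a : ℝ, 0 < a ∧ Filter.Tendsto (fun t : ℕ => ρ ^ (-(t : ℤ)) * g t) Filter.atTop (𝓝 a)}

/-- The union `P_(0,1)` of the sets `P_ρ` over all `ρ ∈ (0, 1)`. -/
def dominantPoleUnion : Set ImpulseResponse :=
  ⋃ ρ ∈ Set.Ioo (0 : ℝ) 1, dominantPoleSet ρ

end

end PosSys

namespace PosSys

/-! Put `h t = ρ⁻ᵗ g t → a > 0` and `f = h - a`. Finite Hankel rank makes the shifts of `f` span a
finite-dimensional space of null sequences, on which a high enough shift power is a contraction.
Hence small perturbations of the constant `1` in this space generate a shift-invariant cone that is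
both finitely generated and non-negative (`exists_invariant_cone`). Late shifts of `h` are `a` plus
a small element, so they lie in this cone; adjoining the finitely many earlier shifts captures `h`
itself. The non-negative matrix of the shift on the generators, scaled by `ρ`, is the state matrix
of a positive realization (`internallyPositive_of_cone`). -/

/-- The left shift on real sequences. -/
def shift : (ℕ → ℝ) →ₗ[ℝ] (ℕ → ℝ) := LinearMap.funLeft ℝ ℝ Nat.succ

theorem shift_apply (f : ℕ → ℝ) (t : ℕ) : shift f t = f (t + 1) := rfl

theorem shift_pow_apply (k : ℕ) (f : ℕ → ℝ) (t : ℕ) : (shift ^ k) f t = f (k + t) := by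
  induction k generalizing f with
  | zero => simp
  | succ k ih =>
    rw [pow_succ, Module.End.mul_apply, ih, shift_apply]
    congr 1
    omega

theorem shift_shift_pow (k : ℕ) (f : ℕ → ℝ) : shift ((shift ^ k) f) = (shift ^ (k + 1)) f := by
  rw [pow_succ', Module.End.mul_apply]

/-- The convex cone generated by a set of sequences. -/
abbrev coneSpan (S : Set (ℕ → ℝ)) : Submodule NNReal (ℕ → ℝ) := Submodule.span NNReal S

theorem coneSpan_smul_mem {S : Set (ℕ → ℝ)} {r : ℝ} (hr : 0 ≤ r) {x : ℕ → ℝ}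
    (hx : x ∈ coneSpan S) : r • x ∈ coneSpan S :=
  (coneSpan S).smul_mem (⟨r, hr⟩ : NNReal) hx

theorem shift_mem_coneSpan {S : Set (ℕ → ℝ)} (hS : ∀ w ∈ S, shift w ∈ coneSpan S)
    {x : ℕ → ℝ} (hx : x ∈ coneSpan S) : shift x ∈ coneSpan S := by
  induction hx using Submodule.span_induction with
  | mem x h => exact hS x h
  | zero => rw [map_zero]; exact zero_mem _
  | add x y _ _ ihx ihy => rw [map_add]; exact add_mem ihx ihy
  | smul r x _ ih =>
    have : shift (r • x) = r • shift x := rfl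
    rw [this]
    exact Submodule.smul_mem _ r ih

/-! ### Positive realizations from invariant cones -/

namespace StateSpace

variable {n : ℕ}

theorem isPositive_of_nonneg (S : StateSpace n) (hA : ∀ i j, 0 ≤ S.A i j) (hb : ∀ i, 0 ≤ S.b i)
    (hc : ∀ i, 0 ≤ S.c i) (hd : 0 ≤ S.d) : S.IsPositive := by
  intro x₀ u hx hu t
  have key : 0 ≤ S.state x₀ u t := by
    induction t with
    | zero => exact hx
    | succ t ih =>
      intro i
      have hAx : 0 ≤ ∑ j, S.A i j * S.state x₀ u t j :=
        Finset.sum_nonneg fun j _ => mul_nonneg (hA i j) (ih j)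
      exact add_nonneg hAx (mul_nonneg (hu t) (hb i))
  exact ⟨key, add_nonneg (Finset.sum_nonneg fun j _ => mul_nonneg (hc j) (key j))
    (mul_nonneg hd (hu t))⟩

theorem output_impulse_zero (S : StateSpace n) : S.output 0 (Pi.single 0 1) 0 = S.d := by
  simp [output, state]

theorem state_impulse_succ (S : StateSpace n) (t : ℕ) :
    S.state 0 (Pi.single 0 1) (t + 1) = (S.A ^ t) *ᵥ S.b := by
  induction t with
  | zero => simp [state]
  | succ t ih =>
    rw [state, ih, pow_succ', Matrix.mulVec_mulVec]
    simp

theorem output_impulse_succ (S : StateSpace n) (t : ℕ) :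
    S.output 0 (Pi.single 0 1) (t + 1) = S.c ⬝ᵥ ((S.A ^ t) *ᵥ S.b) := by
  rw [output, state_impulse_succ]
  simp

end StateSpace

/-- A shift-invariant finitely generated cone of sequences with non-negative leading entries
that contains `h` yields a positive realization of `ρ ^ t * h t`. -/
theorem internallyPositive_of_cone {g : ImpulseResponse} {ρ : ℝ} (hρ : 0 ≤ ρ) {h : ℕ → ℝ}
    (hg : ∀ t, g t = ρ ^ t * h t) {S : Set (ℕ → ℝ)} (hfin : S.Finite) (hne : S.Nonempty)
    (hS : ∀ w ∈ S, shift w ∈ coneSpan S) (h0 : ∀ w ∈ S, 0 ≤ w 0) (hh : h ∈ coneSpan S)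
    (hpos : 0 ≤ h 0) : InternallyPositive g := by
  obtain ⟨n, w, -, rfl⟩ := hfin.fin_param
  have hn : 0 < n := by
    obtain ⟨_, i, _⟩ := hne
    exact i.pos
  have hA : ∀ j, ∃ c : Fin n → NNReal, ∑ i, c i • w i = shift (w j) := fun j =>
    (Submodule.mem_span_range_iff_exists_fun _).mp (hS _ ⟨j, rfl⟩)
  choose A hA using hA
  obtain ⟨b, hb⟩ := (Submodule.mem_span_range_iff_exists_fun _).mp (shift_mem_coneSpan hS hh)
  -- Column `j` of the state matrix holds cone coordinates of `shift (w j)`. The vector `b` encodes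
  -- `shift h` rather than `h`, because `c Aᵗ b` is the output at time `t + 1`; `d` supplies time
  -- `0`.
  let R : StateSpace n :=
    { A := fun i j => ρ * A j i, b := fun i => ρ * b i, c := fun i => w i 0, d := h 0 }
  have hstep : ∀ x : Fin n → ℝ, ∑ i, (R.A *ᵥ x) i • w i = ρ • shift (∑ i, x i • w i) := by
    intro x
    rw [map_sum, Finset.smul_sum]
    simp_rw [map_smul, ← hA, Finset.smul_sum]
    rw [Finset.sum_comm]
    refine Finset.sum_congr rfl fun i _ => ?_
    simp only [Matrix.mulVec, dotProduct, Finset.sum_smul, R]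
    refine Finset.sum_congr rfl fun j _ => ?_
    ext t
    simp only [Pi.smul_apply, NNReal.smul_def, smul_eq_mul]
    ring
  have hinit : ∑ i, R.b i • w i = ρ • shift h := by
    rw [← hb, Finset.smul_sum]
    refine Finset.sum_congr rfl fun i _ => ?_
    ext t
    simp only [R, Pi.smul_apply, NNReal.smul_def, smul_eq_mul]
    ring
  have hpow : ∀ t, ∑ i, ((R.A ^ t) *ᵥ R.b) i • w i = ρ ^ (t + 1) • (shift ^ (t + 1)) h := by
    intro t
    induction t with
    | zero => simpa using hinit
    | succ t ih =>
      rw [pow_succ', ← Matrix.mulVec_mulVec, hstep, ih, map_smul, shift_shift_pow, smul_smul,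
        ← pow_succ']
  refine ⟨n, hn, R, fun t => ?_, R.isPositive_of_nonneg (fun i j => mul_nonneg hρ (A j i).2)
    (fun i => mul_nonneg hρ (b i).2) (fun i => h0 _ ⟨i, rfl⟩) hpos⟩
  cases t with
  | zero => rw [R.output_impulse_zero, hg]; simp [R]
  | succ t =>
    rw [R.output_impulse_succ, hg]
    have := congrFun (hpow t) 0
    rw [Pi.smul_apply, shift_pow_apply, smul_eq_mul, add_zero] at this
    rw [← this, Finset.sum_apply]
    exact Finset.sum_congr rfl fun i _ => mul_comm _ _

/-! ### Spans of shifts of a null sequence -/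

/-- The space spanned by all shifts of a sequence. -/
abbrev shiftSpan (f : ℕ → ℝ) : Submodule ℝ (ℕ → ℝ) :=
  Submodule.span ℝ (Set.range fun k => (shift ^ k) f)

theorem shift_pow_mem_shiftSpan {f v : ℕ → ℝ} (hv : v ∈ shiftSpan f) (m : ℕ) :
    (shift ^ m) v ∈ shiftSpan f := by
  have : shiftSpan f ≤ (shiftSpan f).comap (shift ^ m) := by
    refine Submodule.span_le.mpr ?_
    rintro _ ⟨k, rfl⟩
    refine Submodule.subset_span ⟨m + k, ?_⟩
    simp only [pow_add, Module.End.mul_apply]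
  exact this hv

theorem tendsto_of_mem_shiftSpan {f v : ℕ → ℝ} (hf : Filter.Tendsto f Filter.atTop (𝓝 0))
    (hv : v ∈ shiftSpan f) : Filter.Tendsto v Filter.atTop (𝓝 0) := by
  induction hv using Submodule.span_induction with
  | mem x h =>
    obtain ⟨k, rfl⟩ := h
    refine (hf.comp (Filter.tendsto_add_atTop_nat k)).congr fun t => ?_
    simp only [shift_pow_apply, Function.comp_apply, add_comm]
  | zero => exact tendsto_const_nhds
  | add x y _ _ hx hy =>
    rw [← add_zero (0 : ℝ)]
    exact hx.add hy
  | smul r x _ hx =>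
    rw [← mul_zero r]
    exact hx.const_mul r

theorem exists_pos_bound_of_tendsto {v : ℕ → ℝ} (hv : Filter.Tendsto v Filter.atTop (𝓝 0)) :
    ∃ M : ℝ, 0 < M ∧ ∀ t, |v t| ≤ M := by
  obtain ⟨M, hM⟩ := hv.abs.bddAbove_range
  exact ⟨max M 1, by positivity, fun t => (hM ⟨t, rfl⟩).trans (le_max_left _ _)⟩

/-- If the shifts of a null sequence span a finite-dimensional space, then this space has a
generating family of sequences bounded by `1`, in which the coordinates of the iterated shifts of
any element tend to zero. -/
theorem exists_coordinates {f : ℕ → ℝ} (hf : Filter.Tendsto f Filter.atTop (𝓝 0))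
    [FiniteDimensional ℝ (shiftSpan f)] :
    ∃ (n : ℕ) (e : Fin n → ℕ → ℝ), (∀ i t, |e i t| ≤ 1) ∧ (∀ i, e i ∈ shiftSpan f) ∧
      ∀ v ∈ shiftSpan f, ∃ c : ℕ → Fin n → ℝ, Filter.Tendsto c Filter.atTop (𝓝 0) ∧
        ∀ m, (shift ^ m) v = ∑ i, c m i • e i := by
  let B := Module.finBasis ℝ (shiftSpan f)
  have hM := fun i => exists_pos_bound_of_tendsto (tendsto_of_mem_shiftSpan hf (B i).2)
  choose M hM0 hM using hM
  refine ⟨_, fun i => (M i)⁻¹ • (B i : ℕ → ℝ), fun i t => ?_,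
    fun i => Submodule.smul_mem _ _ (B i).2, fun v hv => ?_⟩
  · beta_reduce
    rw [Pi.smul_apply, smul_eq_mul, abs_mul, abs_of_pos (inv_pos.mpr (hM0 i)),
      inv_mul_le_one₀ (hM0 i)]
    exact hM i t
  · let x : ℕ → shiftSpan f := fun m => ⟨(shift ^ m) v, shift_pow_mem_shiftSpan hv m⟩
    have hx : Filter.Tendsto x Filter.atTop (𝓝 0) := by
      rw [tendsto_subtype_rng, tendsto_pi_nhds]
      intro t
      refine ((tendsto_of_mem_shiftSpan hf hv).comp (Filter.tendsto_add_atTop_nat t)).congr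
        fun m => ?_
      exact (shift_pow_apply m v t).symm
    refine ⟨fun m i => M i * B.equivFun (x m) i, ?_, fun m => ?_⟩
    -- In finite dimension coordinates are continuous even for the topology of pointwise
    -- convergence.
    · have h := ((continuous_equivFun_basis B).tendsto 0).comp hx
      rw [map_zero, tendsto_pi_nhds] at h
      rw [tendsto_pi_nhds]
      intro i
      simpa using (h i).const_mul (M i)
    · have h := congrArg (Subtype.val) (B.sum_equivFun (x m))
      rw [Submodule.coe_sum] at h
      refine (h.symm.trans ?_)
      refine Finset.sum_congr rfl fun i _ => ?_
      rw [smul_smul, mul_right_comm, mul_inv_cancel₀ (hM0 i).ne', one_mul]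
      rfl

/-! ### The invariant cone -/

/-- A cone containing `1` and `1 ± e i` contains `s + ∑ i, c i • e i` once `∑ i, |c i| ≤ s`. -/
theorem const_add_sum_mem_coneSpan {S : Set (ℕ → ℝ)} {n : ℕ} {e : Fin n → ℕ → ℝ}
    (h1 : 1 ∈ coneSpan S) (hadd : ∀ i, 1 + e i ∈ coneSpan S) (hsub : ∀ i, 1 - e i ∈ coneSpan S)
    {c : Fin n → ℝ} {s : ℝ} (hc : ∑ i, |c i| ≤ s) :
    s • (1 : ℕ → ℝ) + ∑ i, c i • e i ∈ coneSpan S := by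
  have key : s • (1 : ℕ → ℝ) + ∑ i, c i • e i
      = (s - ∑ i, |c i|) • (1 : ℕ → ℝ) + ∑ i, (|c i| • (1 : ℕ → ℝ) + c i • e i) := by
    rw [Finset.sum_add_distrib, sub_smul, Finset.sum_smul]
    abel
  rw [key]
  refine add_mem (coneSpan_smul_mem (sub_nonneg.mpr hc) h1) (Submodule.sum_mem _ fun i _ => ?_)
  rcases le_total 0 (c i) with h | h
  · rw [abs_of_nonneg h, ← smul_add]
    exact coneSpan_smul_mem h (hadd i)
  · have : |c i| • (1 : ℕ → ℝ) + c i • e i = (-c i) • (1 - e i) := by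
      rw [abs_of_nonpos h, smul_sub, neg_smul (c i) (e i), sub_neg_eq_add]
    rw [this]
    exact coneSpan_smul_mem (neg_nonneg.mpr h) (hsub i)

theorem exists_sum_abs_le_of_tendsto {n : ℕ} {c : ℕ → Fin n → ℝ}
    (hc : Filter.Tendsto c Filter.atTop (𝓝 0)) {s : ℝ} (hs : 0 < s) :
    ∀ᶠ m in Filter.atTop, ∑ i, |c m i| ≤ s := by
  have h : Filter.Tendsto (fun m => ∑ i, |c m i|) Filter.atTop (𝓝 0) := by
    have := tendsto_finsetSum (Finset.univ : Finset (Fin n)) fun i _ =>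
      ((tendsto_pi_nhds.mp hc) i).abs
    simpa using this
  exact h.eventually_le_const hs

theorem shift_one : shift 1 = 1 := rfl

/-- A null sequence whose shifts span a finite-dimensional space admits a finitely generated
shift-invariant cone of non-negative sequences that contains the constant `1` in its interior
relative to the span of the shifts. -/
theorem exists_invariant_cone {f : ℕ → ℝ} (hf : Filter.Tendsto f Filter.atTop (𝓝 0))
    [FiniteDimensional ℝ (shiftSpan f)] :
    ∃ S : Set (ℕ → ℝ), S.Finite ∧ 1 ∈ S ∧ (∀ w ∈ S, ∀ t, 0 ≤ w t) ∧
      (∀ w ∈ S, shift w ∈ coneSpan S) ∧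
      ∀ s : ℝ, 0 < s → ∃ m, s • (1 : ℕ → ℝ) + (shift ^ m) f ∈ coneSpan S := by
  obtain ⟨n, e, hbd, heV, hcoord⟩ := exists_coordinates hf
  -- `N` is the power that contracts every `e i`; `0 < N` keeps `1 ± e i` themselves (`k = 0`) among
  -- the generators below.
  have hN : ∃ N, 0 < N ∧ ∀ i, ∃ c : Fin n → ℝ, ∑ j, |c j| ≤ 1 ∧
      (shift ^ N) (e i) = ∑ j, c j • e j := by
    choose c hc hce using fun i => hcoord (e i) (heV i)
    have := (Filter.eventually_all.mpr fun i => exists_sum_abs_le_of_tendsto (hc i) one_pos).and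
      (Filter.eventually_gt_atTop 0)
    obtain ⟨N, hN, hN0⟩ := this.exists
    exact ⟨N, hN0, fun i => ⟨c i N, hN i, hce i N⟩⟩
  obtain ⟨N, hN0, hN⟩ := hN
  -- The shift moves `k` to `k + 1`; when `k + 1 = N`, contraction brings the result back into the
  -- cone of `1` and `1 ± e i`.
  let S : Set (ℕ → ℝ) := {1} ∪ (Set.range (fun p : Fin N × Fin n => 1 + (shift ^ p.1.1) (e p.2)) ∪
    Set.range (fun p : Fin N × Fin n => 1 - (shift ^ p.1.1) (e p.2)))
  have h1 : 1 ∈ coneSpan S := Submodule.subset_span (Or.inl rfl)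
  have hadd : ∀ k, k < N → ∀ i, 1 + (shift ^ k) (e i) ∈ coneSpan S := fun k hk i =>
    Submodule.subset_span (Or.inr (Or.inl ⟨(⟨k, hk⟩, i), rfl⟩))
  have hsub : ∀ k, k < N → ∀ i, 1 - (shift ^ k) (e i) ∈ coneSpan S := fun k hk i =>
    Submodule.subset_span (Or.inr (Or.inr ⟨(⟨k, hk⟩, i), rfl⟩))
  have hmem : ∀ {c : Fin n → ℝ} {s : ℝ}, ∑ i, |c i| ≤ s →
      s • (1 : ℕ → ℝ) + ∑ i, c i • e i ∈ coneSpan S := fun hc =>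
    const_add_sum_mem_coneSpan h1 (fun i => hadd 0 hN0 i) (fun i => hsub 0 hN0 i) hc
  refine ⟨S, (Set.finite_singleton _).union ((Set.finite_range _).union (Set.finite_range _)),
    Or.inl rfl, ?_, ?_, fun s hs => ?_⟩
  · rintro w (rfl | ⟨p, rfl⟩ | ⟨p, rfl⟩) t
    · exact zero_le_one
    · have := abs_le.mp (hbd p.2 (p.1 + t))
      simp only [Pi.add_apply, Pi.one_apply, shift_pow_apply]
      linarith
    · have := abs_le.mp (hbd p.2 (p.1 + t))
      simp only [Pi.sub_apply, Pi.one_apply, shift_pow_apply]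
      linarith
  · rintro w (rfl | ⟨⟨k, i⟩, rfl⟩ | ⟨⟨k, i⟩, rfl⟩)
    · exact h1
    · rw [map_add, shift_one, shift_shift_pow]
      rcases Nat.lt_or_ge (k + 1) N with hk | hk
      · exact hadd _ hk i
      · obtain ⟨c, hc, hce⟩ := hN i
        rw [show (k : ℕ) + 1 = N by omega, hce]
        simpa using hmem hc
    · rw [map_sub, shift_one, shift_shift_pow]
      rcases Nat.lt_or_ge (k + 1) N with hk | hk
      · exact hsub _ hk i
      · obtain ⟨c, hc, hce⟩ := hN i
        rw [show (k : ℕ) + 1 = N by omega, hce]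
        have := hmem (c := -c) (s := 1) (by simpa using hc)
        simpa [sub_eq_add_neg] using this
  · obtain ⟨c, hc, hce⟩ := hcoord f (Submodule.subset_span ⟨0, rfl⟩)
    obtain ⟨m, hm⟩ := (exists_sum_abs_le_of_tendsto hc hs).exists
    exact ⟨m, hce m ▸ hmem hm⟩

/-! ### Conclusion from the limit and the Hankel rank -/

/-- If `h ≥ 0` converges to a positive limit and its shifts span a finite-dimensional space, then
`ρ ^ t * h t` is internally positive. -/
theorem internallyPositive_of_tendsto {g : ImpulseResponse} {ρ : ℝ} (hρ : 0 ≤ ρ) {h : ℕ → ℝ}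
    (hg : ∀ t, g t = ρ ^ t * h t) (hpos : ∀ t, 0 ≤ h t) {a : ℝ} (ha : 0 < a)
    (hlim : Filter.Tendsto h Filter.atTop (𝓝 a)) [FiniteDimensional ℝ (shiftSpan h)] :
    InternallyPositive g := by
  let f : ℕ → ℝ := h - a • 1
  have hf : Filter.Tendsto f Filter.atTop (𝓝 0) := by
    have := hlim.sub_const a
    rw [sub_self] at this
    refine this.congr fun t => ?_
    simp [f]
  have hshift : ∀ k, (shift ^ k) f = (shift ^ k) h - a • 1 := fun k => by
    ext t
    simp [f, shift_pow_apply]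
  have hle : shiftSpan f ≤ shiftSpan h ⊔ Submodule.span ℝ {1} := by
    refine Submodule.span_le.mpr ?_
    rintro _ ⟨k, rfl⟩
    simp only [hshift]
    exact sub_mem (Submodule.mem_sup_left (Submodule.subset_span ⟨k, rfl⟩))
      (Submodule.mem_sup_right (Submodule.smul_mem _ _ (Submodule.mem_span_singleton_self _)))
  have : FiniteDimensional ℝ (shiftSpan f) := Submodule.finiteDimensional_of_le hle
  obtain ⟨S, hfin, h1, hnn, hinv, hint⟩ := exists_invariant_cone hf
  obtain ⟨m, hm⟩ := hint a ha
  rw [hshift, add_sub_cancel] at hm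
  -- The chain `h, shift h, …` may stop at `m`, where it has entered the invariant cone of `S`.
  let T : Set (ℕ → ℝ) := S ∪ (fun k => (shift ^ k) h) '' Set.Iic m
  have hST : coneSpan S ≤ coneSpan T := Submodule.span_mono Set.subset_union_left
  refine internallyPositive_of_cone hρ hg (S := T) (hfin.union ((Set.finite_Iic m).image _))
    ⟨1, Or.inl h1⟩ ?_ ?_ (Submodule.subset_span (Or.inr ⟨0, Nat.zero_le m, rfl⟩)) (hpos 0)
  · rintro w (hw | ⟨k, hk, rfl⟩)
    · exact hST (hinv w hw)
    · rcases Nat.lt_or_ge k m with hkm | hkm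
      · exact Submodule.subset_span (Or.inr ⟨k + 1, hkm, (shift_shift_pow k h).symm⟩)
      · obtain rfl : k = m := le_antisymm hk hkm
        exact hST (shift_mem_coneSpan hinv hm)
  · rintro w (hw | ⟨k, -, rfl⟩)
    · exact hnn w hw 0
    · simpa only [shift_pow_apply] using hpos _

/-- The Hankel operator maps the `k`-th unit vector to the `k`-th shift. -/
theorem exists_hankel_eq_shift_pow (g : ImpulseResponse) (k : ℕ) :
    ∃ v : BoundedSeq, ((hankel g v : BoundedSeq) : ℕ → ℝ) = (shift ^ k) g := by
  refine ⟨lp.single ∞ k (1 : ℝ), ?_⟩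
  ext i
  change ∑' j, g (i + j) * (lp.single ∞ k (1 : ℝ) : BoundedSeq) j = _
  rw [tsum_eq_single k]
  · rw [shift_pow_apply, lp.single_apply_self, mul_one, add_comm]
  · intro j hj
    rw [lp.single_apply_ne _ _ _ hj, mul_zero]

/-- Shifts of `g` are Hankel images of unit vectors, and multiplying entry `t` by `ρ⁻ᵗ` turns the
`k`-th shift of `g` into `ρᵏ` times that of `h`. -/
theorem FiniteHankelRank.finiteDimensional_shiftSpan {g : ImpulseResponse}
    (hg : FiniteHankelRank g) {ρ : ℝ} (hρ : ρ ≠ 0) {h : ℕ → ℝ} (hgh : ∀ t, g t = ρ ^ t * h t) :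
    FiniteDimensional ℝ (shiftSpan h) := by
  have : FiniteDimensional ℝ (LinearMap.range (hankel g)) :=
    IsNoetherian.iff_fg.mp (IsNoetherian.iff_rank_lt_aleph0.mpr hg)
  let φ : BoundedSeq →ₗ[ℝ] (ℕ → ℝ) :=
    { toFun := fun v t => (ρ ^ t)⁻¹ * v t
      map_add' := fun v w => by ext t; simp [mul_add]
      map_smul' := fun r v => by ext t; simp [mul_left_comm] }
  refine Submodule.finiteDimensional_of_le (S₂ := (LinearMap.range (hankel g)).map φ) ?_
  refine Submodule.span_le.mpr ?_
  rintro _ ⟨k, rfl⟩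
  obtain ⟨v, hv⟩ := exists_hankel_eq_shift_pow g k
  refine ⟨(ρ ^ k)⁻¹ • hankel g v, Submodule.smul_mem _ _ ⟨v, rfl⟩, ?_⟩
  ext t
  change (ρ ^ t)⁻¹ * ((ρ ^ k)⁻¹ * (hankel g v : BoundedSeq) t) = _
  rw [hv]
  simp only [shift_pow_apply]
  rw [hgh, pow_add]
  field_simp

theorem dominantPoleSet_subset {ρ : ℝ} (hρ : 0 < ρ) :
    dominantPoleSet ρ ⊆ internallyPositiveSet := by
  rintro g ⟨hpos, hrank, a, ha, hlim⟩
  have hgh : ∀ t : ℕ, g t = ρ ^ t * (ρ ^ (-(t : ℤ)) * g t) := fun t => by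
    rw [zpow_neg, zpow_natCast, mul_inv_cancel_left₀ (pow_ne_zero t hρ.ne')]
  have := hrank.finiteDimensional_shiftSpan hρ.ne' hgh
  exact internallyPositive_of_tendsto hρ.le hgh
    (fun t => mul_nonneg (zpow_nonneg hρ.le _) (hpos t)) ha hlim

end PosSys

theorem mainTheorem6 :
    (∀ ρ : ℝ, 0 < ρ → ρ < 1 →
      PosSys.dominantPoleSet ρ ⊆ PosSys.internallyPositiveSet) ∧
    PosSys.dominantPoleUnion ⊆ PosSys.internallyPositiveSet :=
  ⟨fun _ h _ => PosSys.dominantPoleSet_subset h,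
    Set.iUnion₂_subset fun _ h => PosSys.dominantPoleSet_subset h.1⟩
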